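/- Let $K$ be a complete normed field with multiplicative norm $|\cdot|$ (for example $\mathbb{R}$, $\mathbb{C}$, or a field of formal Laurent series in $q$), and let $q\in K$ with $0<|q|<1$. Write $(a;q)_\infty=\prod_{i=0}^\infty(1-aq^i)$. Let $p_k(y,z)\in K[y,z]$, $k\in\mathbb{Z}$, be the polynomials defined by the identity of formal power series in $t$ $$\sum_{n=0}^\infty p_n(y,z)\,t^n=\frac{(-(1-q)t;q)_\infty}{((1-q)yt;q)_\infty\,((1-q)zt;q)_\infty},\qquad p_k(y,z)=0\ \text{ for } k<0.$$ For $N\in\mathbb{Z}$ define the polynomial $\phi_N(y,z)$ by $$\phi_N(y,z)=\det\bigl(p_{N-2i+j}(y,z)\bigr)_{0\le i,j\le N-1}\ (N>0),\qquad \phi_0(y,z)=1,\qquad \phi_N(y,z)=(-1)^{N(N+1)/2}\,\phi_{-N-1}(y,z)\ (N<0).$$ Then for every $N\in\mathbb{Z}$ and all $y,z\in K$ the following six bilinear $q$-difference equations hold: \begin{align*} &y\,\phi_{N+1}(y/q,z)\,\phi_N(y,z/q)-z\,\phi_{N+1}(y,z/q)\,\phi_N(y/q,z)=(y-z)\,\phi_{N+1}(y/q,z/q)\,\phi_N(y,z),\\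 &y\,\phi_{N+1}(y,z/q)\,\phi_N(y/q,z)-z\,\phi_{N+1}(y/q,z)\,\phi_N(y,z/q)=(y-z)\,\phi_{N+1}(y,z)\,\phi_N(y/q,z/q),\\ &q^{-N-1}z\,\phi_{N+1}(y,z)\,\phi_N(y/q,z)+\phi_{N+1}(y/q,z)\,\phi_N(y,z)=(1+z)\,\phi_{N+1}(y/q,z/q)\,\phi_N(y,qz),\\ &\phi_{N+1}(y/q,z)\,\phi_{N-1}(y,z)-\phi_{N+1}(y,z)\,\phi_{N-1}(y/q,z)=(1-q)\,\frac{y}{q}\,\phi_N(y/q,z)\,\phi_N(y,z),\\ &\phi_{N+1}(y,z/q)\,\phi_{N-1}(y,z)-\phi_{N+1}(y,z)\,\phi_{N-1}(y,z/q)=(1-q)\,\frac{z}{q}\,\phi_N(y,z/q)\,\phi_N(y,z),\\ &q^{2N}y\,\phi_N(y/q,z)\,\phi_N(y,z)+q^N(1+z)\,\phi_N(y,qz)\,\phi_N(y/q,z/q)=\frac{1-q^{2N+1}}{1-q}\,\phi_{N+1}(y,z)\,\phi_{N-1}(y/q,z). \end{align*} -/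

import Mathlib

open scoped PowerSeries.WithPiTopology

noncomputable section

namespace QPThree

variable {K : Type*} [NormedField K]

/-- The infinite product `(s; q)_∞ = ∏_{i ≥ 0} (1 - s q ^ i)`, as a formal power series in `s`.
The product is taken for the topology of coefficientwise convergence. -/
def qPoch (q : K) : PowerSeries K :=
  ∏' i : ℕ, (1 - PowerSeries.C (q ^ i) * PowerSeries.X)

/-- The infinite product defining `qPoch` converges when `‖q‖ < 1`. -/
theorem multipliable_qPoch [CompleteSpace K] (q : K) (h : ‖q‖ < 1) :
    Multipliable (fun i : ℕ => (1 - PowerSeries.C (q ^ i) * PowerSeries.X : PowerSeries K)) := by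
  simp_rw [sub_eq_add_neg]
  apply multipliable_one_add_of_summable_prod
  have e : ∀ s : Finset ℕ, ∏ i ∈ s, (-(PowerSeries.C (q ^ i) * PowerSeries.X) : PowerSeries K)
      = PowerSeries.C (∏ i ∈ s, (-(q^i))) * PowerSeries.X ^ s.card := by
    intro s
    rw [map_prod, ← Finset.prod_const, ← Finset.prod_mul_distrib]
    simp
  have hs : Summable (fun s : Finset ℕ => ∏ i ∈ s, (-(q^i))) := by
    apply summable_finsetProd_of_summable_norm
    simpa using summable_geometric_of_lt_one (norm_nonneg q) h
  simp_rw [e]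
  choose! g hg using fun k : ℕ => (show Summable (fun s : Finset ℕ => PowerSeries.coeff k (PowerSeries.C (∏ i ∈ s, (-(q^i))) * PowerSeries.X ^ s.card : PowerSeries K)) by
    have := hs.indicator {s | k = s.card}
    refine this.congr fun s => ?_
    rw [PowerSeries.coeff_C_mul, PowerSeries.coeff_X_pow]
    simp [Set.indicator])
  refine ⟨PowerSeries.mk g, ?_⟩
  rw [PowerSeries.WithPiTopology.hasSum_iff_hasSum_coeff]
  simpa using hg

/-- The ring `K[y, z]`. -/
abbrev Poly (K : Type*) [NormedField K] : Type _ := MvPolynomial (Fin 2) K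

/-- `(c t; q)_∞` for `c ∈ K[y, z]`, as a formal power series in `t` over `K[y, z]`:
the substitution `s = c t` in `(s; q)_∞`. -/
def qPochAt (q : K) (c : Poly K) : PowerSeries (Poly K) :=
  PowerSeries.rescale c (PowerSeries.map MvPolynomial.C (qPoch q))

/-- The generating function
`(-(1 - q) t; q)_∞ / (((1 - q) y t; q)_∞ ((1 - q) z t; q)_∞)` in `K[y, z][[t]]`,
where `y = X 0` and `z = X 1`; the denominator has constant term `1`. -/
def genFun (q : K) : PowerSeries (Poly K) :=
  qPochAt q (MvPolynomial.C (-(1 - q))) *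
    PowerSeries.invOfUnit
      (qPochAt q (MvPolynomial.C (1 - q) * MvPolynomial.X 0) *
        qPochAt q (MvPolynomial.C (1 - q) * MvPolynomial.X 1)) 1

/-- The polynomials `p_k`, `k ∈ ℤ`: the coefficients of the generating function for `k ≥ 0`,
and zero for `k < 0`. -/
def pPoly (q : K) (k : ℤ) : Poly K :=
  if k < 0 then 0 else PowerSeries.coeff k.toNat (genFun q)

/-- The `n × n` determinant with entry `p_{n - 2 i + j}` in row `i` and column `j`
(`0 ≤ i, j < n`); it is `1` for `n = 0`. -/
def phiDet (q : K) (n : ℕ) : Poly K :=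
  Matrix.det (Matrix.of fun i j : Fin n =>
    pPoly q ((n : ℤ) - 2 * ((i : ℕ) : ℤ) + ((j : ℕ) : ℤ)))

/-- The polynomials `φ_N`, `N ∈ ℤ`. -/
def phiPoly (q : K) (N : ℤ) : Poly K :=
  if 0 ≤ N then phiDet q N.toNat
  else (-1) ^ (N * (N + 1) / 2).toNat * phiDet q (-N - 1).toNat

/-- The value `φ_N(y, z)`. -/
def phi (q : K) (N : ℤ) (y z : K) : K :=
  MvPolynomial.eval ![y, z] (phiPoly q N)

end QPThree

end

/-! Each `φ_N` is a staircase determinant in the coefficients of a generating function, and the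
shifts in question multiply that function by linear factors. From G(y,z;t) = (1 - a t) G(y/q,z;t)
with a = (1-q)y/q, the same relation in z, and G(y,z;t/q) = (1 - c t) G(y/q,z/q;t) with c =
-(1-q)/q, all determinants that occur come from one sequence by factors 1 - a t. The rescaling t ↦
t/q only contributes a power of q (`stair_scale`).

Multiplying by 1 - a t amounts to bordering the determinant with the row (1, a, a², …), as column
operations show (`det_cons_geomRow`). The three-term Plücker relation (`bracket_plucker`), applied
to such rows, the last unit vector and one further row of the staircase, gives three bilinear
identities: `plucker_top`, `plucker_bottom`, `plucker_both`.

These extend to all integers by N ↦ -N-1, which exchanges the first two and preserves the third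
(`stair_top`, `stair_bottom`, `stair_both`). Five of the equations are specialisations; the sixth
combines one with the fourth equation. -/

namespace QPThree
-- Three-term Plücker relation
open Matrix

/-- The determinant of the square matrix with rows `x`, `y` and the rows of `F`. -/
def bracket {R : Type*} [CommRing R] {n : ℕ} (F : Fin n → Fin (n + 2) → R)
    (x y : Fin (n + 2) → R) : R :=
  Matrix.det (Matrix.of (Fin.cons x (Fin.cons y F : Fin (n + 1) → Fin (n + 2) → R) :
    Fin (n + 2) → Fin (n + 2) → R))

theorem updateRow_cons_zero {R : Type*} {m : ℕ} (x w : Fin (m + 1) → R)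
    (F : Fin m → Fin (m + 1) → R) :
    (of (Fin.cons x F : Fin (m + 1) → Fin (m + 1) → R)).updateRow 0 w
      = of (Fin.cons w F : Fin (m + 1) → Fin (m + 1) → R) := by
  ext i j
  refine Fin.cases ?_ (fun i => ?_) i <;> simp [updateRow_apply]

section Bracket

variable {R : Type*} [CommRing R] {n : ℕ}

theorem bracket_eq_zero (F : Fin n → Fin (n + 2) → R) (x : Fin (n + 2) → R) (i : Fin n) :
    bracket F (F i) x = 0 := by
  refine det_zero_of_row_eq (i := 0) (j := i.succ.succ) (Fin.succ_ne_zero _).symm ?_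
  rfl

theorem bracket_swap (F : Fin n → Fin (n + 2) → R) (x y : Fin (n + 2) → R) :
    bracket F x y = -bracket F y x := by
  have h := det_permute (Equiv.swap (0 : Fin (n + 2)) 1)
    (of (Fin.cons x (Fin.cons y F : Fin (n + 1) → Fin (n + 2) → R) :
      Fin (n + 2) → Fin (n + 2) → R))
  rw [Equiv.Perm.sign_swap (by simp)] at h
  have e : (of (Fin.cons x (Fin.cons y F : Fin (n + 1) → Fin (n + 2) → R) :
      Fin (n + 2) → Fin (n + 2) → R)).submatrix (Equiv.swap (0 : Fin (n + 2)) 1) id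
      = of (Fin.cons y (Fin.cons x F : Fin (n + 1) → Fin (n + 2) → R)) := by
    ext i j
    refine Fin.cases ?_ (fun i => Fin.cases ?_ (fun i => ?_) i) i
    · simp [submatrix_apply, of_apply]
    · rw [submatrix_apply, Fin.succ_zero_eq_one, Equiv.swap_apply_right]
      rfl
    · rw [submatrix_apply, Equiv.swap_apply_of_ne_of_ne]
      · simp
      · simp
      · simp [Fin.ext_iff]
  rw [e] at h
  unfold bracket
  rw [h]; simp

/-- `bracket F x y` as a linear function of `x`. -/
def bracketLeft (F : Fin n → Fin (n + 2) → R) (y : Fin (n + 2) → R) :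
    (Fin (n + 2) → R) →ₗ[R] R where
  toFun x := bracket F x y
  map_add' s t := by
    have h := det_updateRow_add
      (of (Fin.cons s (Fin.cons y F : Fin (n + 1) → Fin (n + 2) → R) :
        Fin (n + 2) → Fin (n + 2) → R)) 0 s t
    simp only [updateRow_cons_zero] at h
    exact h
  map_smul' c t := by
    have h := det_updateRow_smul
      (of (Fin.cons t (Fin.cons y F : Fin (n + 1) → Fin (n + 2) → R) :
        Fin (n + 2) → Fin (n + 2) → R)) 0 c t
    simp only [updateRow_cons_zero] at h
    exact h

theorem bracketLeft_apply (F : Fin n → Fin (n + 2) → R) (x y : Fin (n + 2) → R) :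
    bracketLeft F y x = bracket F x y := rfl

/-- The three-term Plücker relation. -/
theorem bracket_plucker (F : Fin n → Fin (n + 2) → R) (w x y z : Fin (n + 2) → R) :
    bracket F w x * bracket F y z - bracket F w y * bracket F x z
      + bracket F w z * bracket F x y = 0 := by
  set A : Matrix (Fin (n + 2)) (Fin (n + 2)) R :=
    of (Fin.cons w (Fin.cons x F : Fin (n + 1) → Fin (n + 2) → R)) with hA
  -- Cramer's rule without division: det(A) y is the combination of the rows of A whose coefficients
  -- are the determinants with that row replaced by y. Pairing with z kills the rows of F, so only w
  -- and x survive.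
  have hc := mulVec_cramer Aᵀ y
  have hv : Aᵀ *ᵥ cramer Aᵀ y = ∑ i, cramer Aᵀ y i • A i := by
    ext j; simp [mulVec, dotProduct, Finset.sum_apply, mul_comm]
  rw [hv] at hc
  have h2 := congrArg (bracketLeft F z) hc
  rw [map_sum, map_smul] at h2
  simp only [map_smul, bracketLeft_apply, cramer_transpose_apply, det_transpose] at h2
  rw [Fin.sum_univ_succ, Fin.sum_univ_succ] at h2
  have r0 : A 0 = w := rfl
  have r1 : A (Fin.succ 0) = x := rfl
  have r2 : ∀ i : Fin n, A i.succ.succ = F i := fun _ => rfl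
  simp only [r0, r1, r2, bracket_eq_zero, smul_zero, Finset.sum_const_zero, add_zero] at h2
  have u0 : (A.updateRow 0 y).det = bracket F y x := by
    rw [hA, updateRow_cons_zero]; rfl
  have u1 : (A.updateRow (Fin.succ 0) y).det = bracket F w y := by
    rw [bracket]; congr 1
    ext i j
    refine Fin.cases ?_ (fun i => Fin.cases ?_ (fun i => ?_) i) i <;>
      simp [updateRow_apply, hA, Fin.ext_iff]
  rw [u0, u1] at h2
  have hd : A.det = bracket F w x := rfl
  rw [hd] at h2
  simp only [smul_eq_mul] at h2
  rw [bracket_swap F y x] at h2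
  linear_combination -h2

end Bracket
end QPThree

/-! ### Staircase determinants and their bilinear identities -/

namespace QPThree
open Matrix

/-- The vector `H k, H (k + 1), …`. -/
def seqRow {R : Type*} (m : ℕ) (H : ℤ → R) (k : ℤ) (j : Fin m) : R := H (k + ((j : ℕ) : ℤ))

theorem cons_seqRow {R : Type*} (H : ℤ → R) (m n : ℕ) (k : ℤ) :
    (Fin.cons (seqRow m H (k + 2)) (fun i : Fin n => seqRow m H (k - 2 * ((i : ℕ) : ℤ))) :
      Fin (n + 1) → Fin m → R)
      = fun i : Fin (n + 1) => seqRow m H (k + 2 - 2 * ((i : ℕ) : ℤ)) := by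
  funext i
  refine Fin.cases ?_ (fun i => ?_) i
  · simp
  · simp only [Fin.cons_succ, Fin.val_succ]
    congr 1; push_cast; ring

section Staircase

variable {R : Type*} [CommRing R]

/-- The coefficient sequence of `(1 - a t) H(t)`. -/
def subShift (a : R) (H : ℤ → R) (k : ℤ) : R := H k - a * H (k - 1)

theorem subShift_zero (H : ℤ → R) : subShift 0 H = H := by
  funext k; simp [subShift]

/-- The `n × n` determinant with entry `H (k - 2 i + j)` in row `i` and column `j`. -/
def stairDet (H : ℤ → R) (n : ℕ) (k : ℤ) : R :=
  det (of fun i j : Fin n => H (k - 2 * ((i : ℕ) : ℤ) + ((j : ℕ) : ℤ)))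

/-- The vector of powers of `a`. -/
def geomRow (m : ℕ) (a : R) (j : Fin m) : R := a ^ (j : ℕ)

/-- Subtracting a times the preceding column from each column turns the geometric row into the first
unit vector; expansion along it leaves the differences. -/
theorem det_cons_geomRow {n : ℕ} (a : R) (G : Fin n → ℕ → R) :
    det (of (Fin.cons (geomRow (n + 1) a) (fun i j => G i j) :
        Fin (n + 1) → Fin (n + 1) → R))
      = det (of fun i j : Fin n => G i (j + 1) - a * G i j) := by
  rw [det_eq_of_forall_col_eq_smul_add_pred
    (B := of (Fin.cons (Pi.single 0 1) (fun i => Fin.cons (G i 0)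
      (fun j : Fin n => G i (j + 1) - a * G i j)) : Fin (n + 1) → Fin (n + 1) → R))
    (c := fun _ => a)]
  · rw [det_succ_row_zero, Finset.sum_eq_single 0]
    · simp only [Fin.val_zero, pow_zero, one_mul, of_apply, Fin.cons_zero, Pi.single_eq_same]
      congr 1
    · intro j _ hj
      simp [Pi.single_eq_of_ne hj]
    · simp
  · intro i
    refine Fin.cases ?_ (fun i => ?_) i <;> simp [geomRow]
  · intro i j
    refine Fin.cases ?_ (fun i => ?_) i
    · simp [geomRow, pow_succ, mul_comm]
    · simp

theorem det_cons_single_last {n : ℕ} (F : Fin n → Fin (n + 1) → R) :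
    det (of (Fin.cons (Pi.single (Fin.last n) 1) F : Fin (n + 1) → Fin (n + 1) → R))
      = (-1) ^ n * det (of fun i j : Fin n => F i j.castSucc) := by
  rw [det_succ_row_zero, Finset.sum_eq_single (Fin.last n)]
  · simp only [Fin.val_last, of_apply, Fin.cons_zero, Pi.single_eq_same, mul_one]
    congr 2
    ext i j
    simp
  · intro j _ hj
    simp [Pi.single_eq_of_ne hj]
  · simp

theorem det_cons_geomRow_seqRow (H : ℤ → R) (n : ℕ) (k : ℤ) (a : R) :
    det (of (Fin.cons (geomRow (n + 1) a)
          (fun i : Fin n => seqRow (n + 1) H (k - 2 * ((i : ℕ) : ℤ))) :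
        Fin (n + 1) → Fin (n + 1) → R))
      = stairDet (subShift a H) n (k + 1) := by
  have h := det_cons_geomRow a (fun (i : Fin n) j => H (k - 2 * ((i : ℕ) : ℤ) + (j : ℤ)))
  refine h.trans ?_
  unfold stairDet subShift
  congr 1
  ext i j
  simp only [of_apply]
  refine congrArg₂ (· - ·) (congrArg H ?_) (congrArg (fun x => a * H x) ?_) <;> push_cast <;> ring

/-- Eliminating the row of a turns the row of b into (b - a) times a geometric row one entry
shorter, which is then eliminated in turn. -/
theorem bracket_geomRow_geomRow (H : ℤ → R) (n : ℕ) (k : ℤ) (a b : R) :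
    bracket (fun i : Fin n => seqRow (n + 2) H (k - 2 * ((i : ℕ) : ℤ)))
        (geomRow (n + 2) a) (geomRow (n + 2) b)
      = (b - a) * stairDet (subShift b (subShift a H)) n (k + 2) := by
  have h := det_cons_geomRow a (Fin.cons (fun j => b ^ j)
    (fun i j => H (k - 2 * ((i : ℕ) : ℤ) + (j : ℤ))) : Fin (n + 1) → ℕ → R)
  have h2 := det_cons_geomRow_seqRow (subShift a H) n (k + 1) b
  have e : (of fun i j : Fin (n + 1) =>
      (Fin.cons (fun j => b ^ j) (fun i j => H (k - 2 * ((i : ℕ) : ℤ) + (j : ℤ))) :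
        Fin (n + 1) → ℕ → R) i (j + 1)
      - a * (Fin.cons (fun j => b ^ j) (fun i j => H (k - 2 * ((i : ℕ) : ℤ) + (j : ℤ))) :
        Fin (n + 1) → ℕ → R) i j)
      = (of (Fin.cons (geomRow (n + 1) b) (fun i : Fin n =>
          seqRow (n + 1) (subShift a H) (k + 1 - 2 * ((i : ℕ) : ℤ))) :
          Fin (n + 1) → Fin (n + 1) → R)).updateRow 0 ((b - a) • geomRow (n + 1) b) := by
    rw [updateRow_cons_zero]
    ext i j
    refine Fin.cases ?_ (fun i => ?_) i
    · simp only [of_apply, Fin.cons_zero, geomRow, Pi.smul_apply, smul_eq_mul]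
      ring
    · simp only [of_apply, Fin.cons_succ, seqRow, subShift]
      refine congrArg₂ (· - ·) (congrArg H ?_) (congrArg (fun x => a * H x) ?_) <;> push_cast <;> ring
  rw [e, det_updateRow_smul, updateRow_cons_zero, h2] at h
  rw [show k + 2 = k + 1 + 1 by ring]
  refine Eq.trans ?_ h
  unfold bracket
  congr 2
  ext i j
  refine Fin.cases ?_ (fun i => Fin.cases ?_ (fun i => ?_) i) i <;> rfl

theorem bracket_geomRow_seqRow (H : ℤ → R) (n : ℕ) (k : ℤ) (a : R) :
    bracket (fun i : Fin n => seqRow (n + 2) H (k - 2 * ((i : ℕ) : ℤ)))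
        (geomRow (n + 2) a) (seqRow (n + 2) H (k + 2))
      = stairDet (subShift a H) (n + 1) (k + 3) := by
  unfold bracket
  rw [cons_seqRow, det_cons_geomRow_seqRow]
  congr 1; ring

theorem bracket_single_geomRow (H : ℤ → R) (n : ℕ) (k : ℤ) (a : R) :
    bracket (fun i : Fin n => seqRow (n + 2) H (k - 2 * ((i : ℕ) : ℤ)))
        (Pi.single (Fin.last (n + 1)) 1) (geomRow (n + 2) a)
      = (-1) ^ (n + 1) * stairDet (subShift a H) n (k + 1) := by
  unfold bracket
  rw [det_cons_single_last, ← det_cons_geomRow_seqRow]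
  congr 2
  ext i j
  refine Fin.cases ?_ (fun i => ?_) i <;> rfl

theorem bracket_single_seqRow (H : ℤ → R) (n : ℕ) (k : ℤ) :
    bracket (fun i : Fin n => seqRow (n + 2) H (k - 2 * ((i : ℕ) : ℤ)))
        (Pi.single (Fin.last (n + 1)) 1) (seqRow (n + 2) H (k + 2))
      = (-1) ^ (n + 1) * stairDet H (n + 1) (k + 2) := by
  unfold bracket
  rw [cons_seqRow, det_cons_single_last]
  rfl

/-- The last row is H(-n), …, H(0), that is, the last unit vector. This turns the mismatched size
and index in the Plücker identities into genuine staircases. -/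
theorem stairDet_succ_self (H : ℤ → R) (h0 : H 0 = 1) (hneg : ∀ k < 0, H k = 0) (n : ℕ) :
    stairDet H (n + 1) n = stairDet H n n := by
  unfold stairDet
  rw [det_succ_row _ (Fin.last n), Finset.sum_eq_single (Fin.last n)]
  · have e : (n : ℤ) - 2 * (n : ℤ) + (n : ℤ) = 0 := by ring
    simp only [of_apply, Fin.val_last, e, h0, Even.neg_one_pow ⟨n, rfl⟩, one_mul]
    congr 1
    ext i j
    simp
  · intro j _ hj
    have hj' : (j : ℕ) < n := Fin.val_lt_last hj
    simp only [of_apply, Fin.val_last]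
    rw [hneg _ (by omega)]
    simp
  · simp

theorem plucker_top (H : ℤ → R) (n : ℕ) (k : ℤ) (a b : R) :
    a * stairDet (subShift b H) (n + 1) (k + 3) * stairDet (subShift a H) n (k + 2)
        - b * stairDet (subShift a H) (n + 1) (k + 3) * stairDet (subShift b H) n (k + 2)
      = (a - b) * stairDet H (n + 1) (k + 3) * stairDet (subShift b (subShift a H)) n (k + 2) := by
  -- Since 0 ^ 0 = 1, `geomRow` at 0 is the first unit vector; it represents the trivial factor 1 -
  -- 0·t.
  have h := bracket_plucker (fun i : Fin n => seqRow (n + 2) H (k - 2 * ((i : ℕ) : ℤ)))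
    (geomRow (n + 2) 0) (geomRow (n + 2) a) (geomRow (n + 2) b) (seqRow (n + 2) H (k + 2))
  simp only [bracket_geomRow_geomRow, bracket_geomRow_seqRow, subShift_zero] at h
  linear_combination h

theorem plucker_bottom (H : ℤ → R) (n : ℕ) (k : ℤ) (a b : R) :
    a * stairDet (subShift a H) n (k + 2) * stairDet (subShift b H) n (k + 1)
        - b * stairDet (subShift b H) n (k + 2) * stairDet (subShift a H) n (k + 1)
      = (a - b) * stairDet (subShift b (subShift a H)) n (k + 2) * stairDet H n (k + 1) := by
  have h := bracket_plucker (fun i : Fin n => seqRow (n + 2) H (k - 2 * ((i : ℕ) : ℤ)))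
    (Pi.single (Fin.last (n + 1)) 1) (geomRow (n + 2) 0) (geomRow (n + 2) a) (geomRow (n + 2) b)
  simp only [bracket_geomRow_geomRow, bracket_single_geomRow, subShift_zero] at h
  -- Each term carries one sign from expanding along the last unit vector; multiplying by it again
  -- removes it.
  have hs : ((-1 : R) ^ (n + 1)) * (-1) ^ (n + 1) = 1 := by rw [← mul_pow]; simp
  linear_combination (-1 : R) ^ (n + 1) * h -
      (a * stairDet (subShift a H) n (k + 2) * stairDet (subShift b H) n (k + 1)
        - b * stairDet (subShift b H) n (k + 2) * stairDet (subShift a H) n (k + 1)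
      - (a - b) * stairDet (subShift b (subShift a H)) n (k + 2) * stairDet H n (k + 1)) * hs

theorem plucker_both (H : ℤ → R) (n : ℕ) (k : ℤ) (a b : R) :
    stairDet (subShift b H) (n + 1) (k + 3) * stairDet (subShift a H) n (k + 1)
        - stairDet (subShift a H) (n + 1) (k + 3) * stairDet (subShift b H) n (k + 1)
      = (a - b) * stairDet H (n + 1) (k + 2) * stairDet (subShift b (subShift a H)) n (k + 2) := by
  have h := bracket_plucker (fun i : Fin n => seqRow (n + 2) H (k - 2 * ((i : ℕ) : ℤ)))
    (Pi.single (Fin.last (n + 1)) 1) (geomRow (n + 2) a) (geomRow (n + 2) b)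
    (seqRow (n + 2) H (k + 2))
  simp only [bracket_geomRow_geomRow, bracket_single_geomRow, bracket_single_seqRow,
    bracket_geomRow_seqRow] at h
  have hs : ((-1 : R) ^ (n + 1)) * (-1) ^ (n + 1) = 1 := by rw [← mul_pow]; simp
  linear_combination (-1 : R) ^ (n + 1) * h -
      (stairDet (subShift b H) (n + 1) (k + 3) * stairDet (subShift a H) n (k + 1)
        - stairDet (subShift a H) (n + 1) (k + 3) * stairDet (subShift b H) n (k + 1)
      - (a - b) * stairDet H (n + 1) (k + 2) * stairDet (subShift b (subShift a H)) n (k + 2)) * hs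

end Staircase
end QPThree

/-! ### Extension to all integers by reflection, and rescaling -/

namespace QPThree
open Matrix

/-- A proposition about an integer holds if it holds for each natural number `n` and for its
reflection `-n - 1`. -/
theorem int_reflect_cases (P : ℤ → Prop) (hnat : ∀ n : ℕ, P n) (hneg : ∀ n : ℕ, P (-n - 1))
    (N : ℤ) : P N := by
  rcases le_or_gt 0 N with h | h
  · simpa [Int.toNat_of_nonneg h] using hnat N.toNat
  · have := hneg (-N - 1).toNat
    rwa [Int.toNat_of_nonneg (by omega), show -(-N - 1) - 1 = N by ring] at this

theorem triangle_succ (n : ℕ) : (n + 1) * (n + 1 + 1) / 2 = n * (n + 1) / 2 + (n + 1) := by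
  rw [show (n + 1) * (n + 1 + 1) = n * (n + 1) + (n + 1) * 2 by ring,
    Nat.add_mul_div_right _ _ two_pos]

theorem int_triangle_succ (N : ℤ) :
    (N + 1) * (N + 1 + 1) / 2 = N * (N + 1) / 2 + (N + 1) := by
  rw [show (N + 1) * (N + 1 + 1) = N * (N + 1) + (N + 1) * 2 by ring,
    Int.add_mul_ediv_right _ _ two_ne_zero]

section StaircaseInt

variable {R : Type*} [CommRing R]

/-- The staircase determinants of a sequence, extended to all integers `N` by the symmetry
`N ↦ -N - 1`. -/
def stair (H : ℤ → R) (N : ℤ) : R :=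
  if 0 ≤ N then stairDet H N.toNat N.toNat
  else (-1) ^ (N * (N + 1) / 2).toNat * stairDet H (-N - 1).toNat (-N - 1).toNat

theorem stair_natCast (H : ℤ → R) (n : ℕ) : stair H n = stairDet H n n := by
  simp [stair]

theorem stair_reflect (H : ℤ → R) (n : ℕ) :
    stair H (-n - 1) = (-1) ^ (n * (n + 1) / 2) * stair H n := by
  have h : ¬ (0 : ℤ) ≤ -n - 1 := by omega
  have e : ((-n - 1 : ℤ) * (-n - 1 + 1) / 2).toNat = n * (n + 1) / 2 := by
    rw [show (-n - 1 : ℤ) * (-n - 1 + 1) = ((n * (n + 1) : ℕ) : ℤ) by push_cast; ring]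
    omega
  rw [stair_natCast, stair, if_neg h, e]
  simp

theorem stair_zero (H : ℤ → R) : stair H 0 = 1 := by
  simpa [stairDet] using stair_natCast H 0

theorem stair_neg_one (H : ℤ → R) : stair H (-1) = 1 := by
  simpa [stair_zero] using stair_reflect H 0

theorem stair_reflect_mul_self (H H' : ℤ → R) (n : ℕ) :
    stair H (-n - 1) * stair H' (-n - 1) = stair H n * stair H' n := by
  rw [stair_reflect, stair_reflect, mul_mul_mul_comm, ← mul_pow]
  simp

/-- The triangular exponents of n-1 and n+1 differ by 2n+1, which is odd; hence the minus sign. In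
`stair_both` it offsets the exchange of the two products. -/
theorem stair_reflect_mul_skip (H H' : ℤ → R) (n : ℕ) :
    stair H (-n - 1 + 1) * stair H' (-n - 1 - 1) = -(stair H (n - 1) * stair H' (n + 1)) := by
  have e (m : ℕ) : (-(m : ℤ) - 1 - 1) = -((m + 1 : ℕ) : ℤ) - 1 := by push_cast; ring
  rw [e, stair_reflect, triangle_succ]
  cases n with
  | zero => simp [stair_neg_one, stair_zero]
  | succ m =>
    have e' : (-((m + 1 : ℕ) : ℤ) - 1 + 1) = -m - 1 := by push_cast; ring
    have e'' : (((m + 1 : ℕ) : ℤ) - 1) = m := by push_cast; ring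
    rw [e', e'', stair_reflect, triangle_succ]
    have hs : ((-1 : R) ^ (m * (m + 1) / 2)) * (-1) ^ (m * (m + 1) / 2) = 1 := by
      rw [← mul_pow]; simp
    have ht : ((-1 : R) ^ m) * (-1) ^ m = 1 := by
      rw [← mul_pow]; simp
    push_cast
    simp only [pow_add, pow_one]
    linear_combination (-stair H m * stair H' (m + 1 + 1)) *
      ((-1 : R) ^ m * (-1) ^ m * hs + ht)

/-- The sequence of coefficients of a power series with constant term `1`. -/
structure IsNormalized (H : ℤ → R) : Prop where
  zero : H 0 = 1
  neg : ∀ k < 0, H k = 0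

theorem IsNormalized.subShift {H : ℤ → R} (hH : IsNormalized H) (a : R) :
    IsNormalized (subShift a H) where
  zero := by simp [QPThree.subShift, hH.zero, hH.neg]
  neg k hk := by simp [QPThree.subShift, hH.neg k hk, hH.neg (k - 1) (by omega)]

theorem IsNormalized.stairDet_succ_self {H : ℤ → R} (hH : IsNormalized H) (n : ℕ) :
    stairDet H (n + 1) n = stair H n := by
  rw [QPThree.stairDet_succ_self H hH.zero hH.neg, stair_natCast]

theorem IsNormalized.stairDet_pred {H : ℤ → R} (hH : IsNormalized H) (n : ℕ) :
    stairDet H n (n - 1) = stair H (n - 1) := by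
  cases n with
  | zero => simp [stairDet, stair_neg_one]
  | succ m =>
    have e : ((m + 1 : ℕ) : ℤ) - 1 = m := by push_cast; ring
    rw [e, hH.stairDet_succ_self]

theorem stair_natCast_succ (H : ℤ → R) (n : ℕ) : stair H (n + 1) = stairDet H (n + 1) (n + 1) :=
  stair_natCast H (n + 1)

theorem stair_top_natCast (H : ℤ → R) (n : ℕ) (a b : R) :
    a * stair (subShift b H) (n + 1) * stair (subShift a H) n
        - b * stair (subShift a H) (n + 1) * stair (subShift b H) n
      = (a - b) * stair H (n + 1) * stair (subShift b (subShift a H)) n := by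
  simp only [stair_natCast, stair_natCast_succ]
  have h := plucker_top H n (n - 2) a b
  rwa [show (n : ℤ) - 2 + 3 = n + 1 by ring, show (n : ℤ) - 2 + 2 = n by ring] at h

theorem stair_bottom_natCast {H : ℤ → R} (hH : IsNormalized H) (n : ℕ) (a b : R) :
    a * stair (subShift a H) (n + 1) * stair (subShift b H) n
        - b * stair (subShift b H) (n + 1) * stair (subShift a H) n
      = (a - b) * stair (subShift b (subShift a H)) (n + 1) * stair H n := by
  have h := plucker_bottom H (n + 1) (n - 1) a b
  rw [show (n : ℤ) - 1 + 2 = n + 1 by ring, show (n : ℤ) - 1 + 1 = n by ring] at h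
  simpa only [hH.stairDet_succ_self, (hH.subShift _).stairDet_succ_self,
    ← stair_natCast_succ] using h

theorem stair_both_natCast {H : ℤ → R} (hH : IsNormalized H) (n : ℕ) (a b : R) :
    stair (subShift b H) (n + 1) * stair (subShift a H) (n - 1)
        - stair (subShift a H) (n + 1) * stair (subShift b H) (n - 1)
      = (a - b) * stair H n * stair (subShift b (subShift a H)) n := by
  have h := plucker_both H n (n - 2) a b
  rw [show (n : ℤ) - 2 + 2 = n by ring, show (n : ℤ) - 2 + 1 = n - 1 by ring,
    show (n : ℤ) - 2 + 3 = n + 1 by ring] at h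
  simpa only [hH.stairDet_succ_self, (hH.subShift _).stairDet_pred,
    ← stair_natCast_succ, ← stair_natCast] using h

/-- The sign s does not depend on the sequences, so it factors out of a whole bilinear identity. The
larger and smaller index trade places, so top and bottom identities are exchanged. -/
theorem exists_stair_reflect_mul_succ (n : ℕ) : ∃ s : R, s * s = 1 ∧ ∀ H H' : ℤ → R,
    stair H (-n - 2 + 1) * stair H' (-n - 2) = s * (stair H n * stair H' (n + 1)) := by
  refine ⟨(-1) ^ (n * (n + 1) / 2) * (-1) ^ ((n + 1) * (n + 1 + 1) / 2), ?_, fun H H' => ?_⟩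
  · rw [mul_mul_mul_comm, ← mul_pow, ← mul_pow]; simp
  · have h := stair_reflect H' (n + 1)
    push_cast at h
    rw [show (-n - 2 + 1 : ℤ) = -n - 1 by ring, stair_reflect,
      show (-n - 2 : ℤ) = -(n + 1) - 1 by ring, h]
    ring

theorem stair_top {H : ℤ → R} (hH : IsNormalized H) (a b : R) (N : ℤ) :
    a * stair (subShift b H) (N + 1) * stair (subShift a H) N
        - b * stair (subShift a H) (N + 1) * stair (subShift b H) N
      = (a - b) * stair H (N + 1) * stair (subShift b (subShift a H)) N := by
  refine int_reflect_cases (fun N => a * stair (subShift b H) (N + 1) * stair (subShift a H) N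
        - b * stair (subShift a H) (N + 1) * stair (subShift b H) N
      = (a - b) * stair H (N + 1) * stair (subShift b (subShift a H)) N)
    (fun n => stair_top_natCast H n a b) (fun n => ?_) N
  cases n with
  -- At N = -1 both indices, 0 and -1, give the value 1.
  | zero => simp [stair_zero, stair_neg_one]
  | succ m =>
    obtain ⟨s, -, hs⟩ := exists_stair_reflect_mul_succ (R := R) m
    have e : (-((m + 1 : ℕ) : ℤ) - 1) = -m - 2 := by push_cast; ring
    simp only [e, mul_assoc, hs]
    linear_combination s * stair_bottom_natCast hH m a b

theorem stair_bottom {H : ℤ → R} (hH : IsNormalized H) (a b : R) (N : ℤ) :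
    a * stair (subShift a H) (N + 1) * stair (subShift b H) N
        - b * stair (subShift b H) (N + 1) * stair (subShift a H) N
      = (a - b) * stair (subShift b (subShift a H)) (N + 1) * stair H N := by
  refine int_reflect_cases (fun N => a * stair (subShift a H) (N + 1) * stair (subShift b H) N
        - b * stair (subShift b H) (N + 1) * stair (subShift a H) N
      = (a - b) * stair (subShift b (subShift a H)) (N + 1) * stair H N)
    (fun n => stair_bottom_natCast hH n a b) (fun n => ?_) N
  cases n with
  | zero => simp [stair_zero, stair_neg_one]
  | succ m =>
    obtain ⟨s, -, hs⟩ := exists_stair_reflect_mul_succ (R := R) m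
    have e : (-((m + 1 : ℕ) : ℤ) - 1) = -m - 2 := by push_cast; ring
    simp only [e, mul_assoc, hs]
    linear_combination s * stair_top_natCast H m a b

theorem stair_both {H : ℤ → R} (hH : IsNormalized H) (a b : R) (N : ℤ) :
    stair (subShift b H) (N + 1) * stair (subShift a H) (N - 1)
        - stair (subShift a H) (N + 1) * stair (subShift b H) (N - 1)
      = (a - b) * stair H N * stair (subShift b (subShift a H)) N := by
  refine int_reflect_cases
    (fun N => stair (subShift b H) (N + 1) * stair (subShift a H) (N - 1)
        - stair (subShift a H) (N + 1) * stair (subShift b H) (N - 1)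
      = (a - b) * stair H N * stair (subShift b (subShift a H)) N)
    (fun n => stair_both_natCast hH n a b) (fun n => ?_) N
  simp only [mul_assoc, stair_reflect_mul_skip, stair_reflect_mul_self]
  linear_combination stair_both_natCast hH n a b

end StaircaseInt

section Scaling

variable {K : Type*} [Field K]

theorem prod_zpow_sub (c : K) (n : ℕ) :
    ∏ i ∈ Finset.range n, c ^ ((n : ℤ) - i) = c ^ (n * (n + 1) / 2) := by
  induction n with
  | zero => simp
  | succ n ih =>
    rw [Finset.prod_range_succ', triangle_succ, pow_add, ← ih]
    congr 1
    · refine Finset.prod_congr rfl fun i _ => ?_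
      congr 1; push_cast; ring
    · rw [← zpow_natCast]; simp

/-- Row i contributes c^(n-2i) and column j contributes c^j; the exponents n - i add up to n(n+1)/2.
-/
theorem stairDet_scale {c : K} (hc : c ≠ 0) (H : ℤ → K) (n : ℕ) :
    stairDet (fun k => c ^ k * H k) n n = c ^ (n * (n + 1) / 2) * stairDet H n n := by
  have e : (of fun i j : Fin n => c ^ ((n : ℤ) - 2 * ((i : ℕ) : ℤ) + ((j : ℕ) : ℤ)) *
        H ((n : ℤ) - 2 * ((i : ℕ) : ℤ) + ((j : ℕ) : ℤ)))
      = of fun i j : Fin n => c ^ ((n : ℤ) - 2 * ((i : ℕ) : ℤ)) *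
        (of fun i j : Fin n => c ^ ((j : ℕ) : ℤ) *
          (of fun i j : Fin n => H ((n : ℤ) - 2 * ((i : ℕ) : ℤ) + ((j : ℕ) : ℤ))) i j) i j := by
    ext i j
    simp only [of_apply]
    rw [zpow_add₀ hc, mul_assoc]
  unfold stairDet
  rw [e, det_mul_column, det_mul_row, ← mul_assoc, ← Finset.prod_mul_distrib,
    ← prod_zpow_sub c, ← Fin.prod_univ_eq_prod_range (fun i => c ^ ((n : ℤ) - i))]
  congr 1
  refine Finset.prod_congr rfl fun i _ => ?_
  rw [← zpow_add₀ hc]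
  congr 1; ring

theorem stair_scale {c : K} (hc : c ≠ 0) (H : ℤ → K) (N : ℤ) :
    stair (fun k => c ^ k * H k) N = c ^ (N * (N + 1) / 2) * stair H N := by
  have hz (n : ℕ) : (n : ℤ) * (n + 1) / 2 = ((n * (n + 1) / 2 : ℕ) : ℤ) := by push_cast; rfl
  refine int_reflect_cases
    (fun N => stair (fun k => c ^ k * H k) N = c ^ (N * (N + 1) / 2) * stair H N)
    (fun n => ?_) (fun n => ?_) N
  · rw [stair_natCast, stair_natCast, stairDet_scale hc, hz, zpow_natCast]
  · rw [stair_reflect, stair_reflect, stair_natCast, stair_natCast, stairDet_scale hc,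
      show (-n - 1 : ℤ) * (-n - 1 + 1) = n * (n + 1) by ring, hz, zpow_natCast]
    ring

end Scaling
end QPThree

/-! ### Functional equations of the generating function -/

noncomputable section
namespace QPThree
open PowerSeries

section GenFun

variable {K : Type*} [NormedField K]

/-- `(c t; q)_∞` as a formal power series in `t` over `K`. -/
def qPochScaled (q c : K) : PowerSeries K := rescale c (qPoch q)

theorem qPoch_eq [CompleteSpace K] {q : K} (hq : ‖q‖ < 1) :
    qPoch q = (1 - X) * rescale q (qPoch q) := by
  have hm := multipliable_qPoch q hq
  -- Rescaling multiplies each coefficient by a constant, so it is continuous coefficientwise and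
  -- passes through the infinite product, shifting its index by one.
  have hcont : Continuous (rescale q : PowerSeries K →+* PowerSeries K) := by
    refine continuous_pi fun n => ?_
    have h : Continuous fun f : PowerSeries K => q ^ (n ()) * coeff (n ()) f :=
      continuous_const.mul (WithPiTopology.continuous_coeff K _)
    refine h.congr fun f => ?_
    rw [← coeff_rescale, coeff_def rfl]
    rfl
  have hr := hm.map_tprod (rescale q) hcont
  have hm' := hm.map (rescale q) hcont
  have e : ∀ i : ℕ, rescale q (1 - C (q ^ i) * X : PowerSeries K) = 1 - C (q ^ (i + 1)) * X := by
    intro i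
    have hC : rescale q (C (q ^ i)) = C (q ^ i) := by
      ext n
      rw [coeff_rescale, coeff_C]
      split_ifs with hn <;> simp [hn]
    rw [map_sub, map_one, map_mul, rescale_X, hC, pow_succ, map_mul, mul_assoc]
  have h := tprod_eq_zero_mul' (f := fun i : ℕ => (1 - C (q ^ i) * X : PowerSeries K))
    (by simpa only [Function.comp_def, e] using hm')
  simp only [e] at hr
  unfold qPoch
  rw [hr, h]
  simp

theorem constantCoeff_qPoch [CompleteSpace K] {q : K} (hq : ‖q‖ < 1) :
    constantCoeff (qPoch q) = 1 := by
  rw [qPoch, (multipliable_qPoch q hq).map_tprod constantCoeff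
    (WithPiTopology.continuous_constantCoeff K)]
  simp

theorem qPochScaled_eq [CompleteSpace K] {q : K} (hq : ‖q‖ < 1) (c : K) :
    qPochScaled q c = (1 - C c * X) * qPochScaled q (c * q) := by
  have h := congrArg (rescale c) (qPoch_eq hq)
  rw [map_mul, rescale_rescale] at h
  rw [qPochScaled, h]
  congr 1
  · simp [rescale_X]
  · rw [mul_comm]; rfl

theorem rescale_qPochScaled (q a c : K) :
    rescale a (qPochScaled q c) = qPochScaled q (c * a) := by
  rw [qPochScaled, rescale_rescale]; rfl

theorem constantCoeff_qPochScaled [CompleteSpace K] {q : K} (hq : ‖q‖ < 1) (c : K) :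
    constantCoeff (qPochScaled q c) = 1 := by
  rw [qPochScaled, ← coeff_zero_eq_constantCoeff_apply, coeff_rescale,
    coeff_zero_eq_constantCoeff_apply, constantCoeff_qPoch hq, pow_zero, one_mul]

theorem qPochScaled_ne_zero [CompleteSpace K] {q : K} (hq : ‖q‖ < 1) (c : K) :
    qPochScaled q c ≠ 0 := by
  intro h
  have := congrArg constantCoeff h
  simp [constantCoeff_qPochScaled hq] at this

theorem map_eval_qPochAt (q y z : K) (c : Poly K) :
    PowerSeries.map (MvPolynomial.eval ![y, z]) (qPochAt q c)
      = qPochScaled q (MvPolynomial.eval ![y, z] c) := by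
  ext n
  simp [qPochAt, qPochScaled, coeff_rescale]

/-- The generating function of the values `p_n(y, z)`. -/
def genFunAt (q y z : K) : PowerSeries K :=
  PowerSeries.map (MvPolynomial.eval ![y, z]) (genFun q)

theorem constantCoeff_qPochAt [CompleteSpace K] {q : K} (hq : ‖q‖ < 1) (c : Poly K) :
    constantCoeff (qPochAt q c) = 1 := by
  rw [qPochAt, ← coeff_zero_eq_constantCoeff_apply, coeff_rescale, coeff_map,
    coeff_zero_eq_constantCoeff_apply, constantCoeff_qPoch hq]
  simp

theorem genFunAt_mul [CompleteSpace K] {q : K} (hq : ‖q‖ < 1) (y z : K) :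
    genFunAt q y z * (qPochScaled q ((1 - q) * y) * qPochScaled q ((1 - q) * z))
      = qPochScaled q (-(1 - q)) := by
  have h : genFun q * (qPochAt q (MvPolynomial.C (1 - q) * MvPolynomial.X 0) *
      qPochAt q (MvPolynomial.C (1 - q) * MvPolynomial.X 1))
      = qPochAt q (MvPolynomial.C (-(1 - q))) := by
    rw [genFun, mul_assoc, mul_comm (invOfUnit _ _), mul_invOfUnit, mul_one]
    simp [constantCoeff_qPochAt hq]
  have h2 := congrArg (PowerSeries.map (MvPolynomial.eval ![y, z])) h
  rw [map_mul, map_mul, map_eval_qPochAt, map_eval_qPochAt, map_eval_qPochAt] at h2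
  simpa [genFunAt] using h2

theorem constantCoeff_genFunAt [CompleteSpace K] {q : K} (hq : ‖q‖ < 1) (y z : K) :
    constantCoeff (genFunAt q y z) = 1 := by
  have h := congrArg constantCoeff (genFunAt_mul hq y z)
  simpa only [map_mul, constantCoeff_qPochScaled hq, mul_one] using h

theorem genFunAt_swap [CompleteSpace K] {q : K} (hq : ‖q‖ < 1) (y z : K) :
    genFunAt q y z = genFunAt q z y := by
  refine mul_right_cancel₀ (mul_ne_zero (qPochScaled_ne_zero hq ((1 - q) * y))
    (qPochScaled_ne_zero hq ((1 - q) * z))) ?_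
  rw [genFunAt_mul hq, mul_comm (qPochScaled q _), genFunAt_mul hq]

theorem genFunAt_eq_left [CompleteSpace K] {q : K} (hq0 : q ≠ 0) (hq : ‖q‖ < 1) (y z : K) :
    genFunAt q y z = (1 - C ((1 - q) * (y / q)) * X) * genFunAt q (y / q) z := by
  refine mul_right_cancel₀ (mul_ne_zero (qPochScaled_ne_zero hq ((1 - q) * y))
    (qPochScaled_ne_zero hq ((1 - q) * z))) ?_
  have h1 := genFunAt_mul hq y z
  have h2 := genFunAt_mul hq (y / q) z
  have h3 := qPochScaled_eq hq ((1 - q) * (y / q))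
  rw [show (1 - q) * (y / q) * q = (1 - q) * y by field_simp] at h3
  rw [h3] at h2
  rw [h1, ← h2]
  ring

/-- Rescaling by 1/q divides y and z by q in the denominator and exposes one extra linear factor of
the numerator. -/
theorem rescale_genFunAt [CompleteSpace K] {q : K} (hq0 : q ≠ 0) (hq : ‖q‖ < 1) (y z : K) :
    rescale q⁻¹ (genFunAt q y z)
      = (1 - C (-(1 - q) / q) * X) * genFunAt q (y / q) (z / q) := by
  refine mul_right_cancel₀ (mul_ne_zero (qPochScaled_ne_zero hq ((1 - q) * (y / q)))
    (qPochScaled_ne_zero hq ((1 - q) * (z / q)))) ?_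
  have h1 := congrArg (rescale q⁻¹) (genFunAt_mul hq y z)
  have h2 := genFunAt_mul hq (y / q) (z / q)
  have h3 := qPochScaled_eq hq (-(1 - q) / q)
  rw [div_mul_cancel₀ _ hq0] at h3
  rw [map_mul, map_mul] at h1
  simp only [rescale_qPochScaled, ← div_eq_mul_inv, mul_div_assoc] at h1
  rw [h1, mul_assoc, h2, ← h3]

/-- The values `p_k(y, z)`, for `k ∈ ℤ`. -/
def pVal (q y z : K) (k : ℤ) : K := MvPolynomial.eval ![y, z] (pPoly q k)

theorem pVal_natCast (q y z : K) (n : ℕ) : pVal q y z n = coeff n (genFunAt q y z) := by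
  simp [pVal, pPoly, genFunAt, not_lt.mpr (Int.natCast_nonneg n)]

theorem pVal_neg (q y z : K) {k : ℤ} (hk : k < 0) : pVal q y z k = 0 := by
  simp [pVal, pPoly, hk]

theorem isNormalized_pVal [CompleteSpace K] {q : K} (hq : ‖q‖ < 1) (y z : K) :
    IsNormalized (pVal q y z) where
  zero := by simpa [constantCoeff_genFunAt hq] using pVal_natCast q y z 0
  neg _ hk := pVal_neg q y z hk

theorem subShift_pVal (q y z a : K) (k : ℤ) : subShift a (pVal q y z) k
    = if k < 0 then 0 else coeff k.toNat ((1 - C a * X) * genFunAt q y z) := by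
  split_ifs with hk
  · simp [subShift, pVal_neg _ _ _ hk, pVal_neg _ _ _ (show k - 1 < 0 by omega)]
  · obtain ⟨n, rfl⟩ := Int.eq_ofNat_of_zero_le (not_lt.mp hk)
    rw [Int.toNat_natCast, subShift, pVal_natCast, sub_mul, one_mul, map_sub, mul_assoc,
      coeff_C_mul]
    cases n with
    | zero => simp [pVal_neg]
    | succ n =>
      rw [show ((n + 1 : ℕ) : ℤ) - 1 = n by push_cast; ring, pVal_natCast, coeff_succ_X_mul]

theorem subShift_pVal_left [CompleteSpace K] {q : K} (hq0 : q ≠ 0) (hq : ‖q‖ < 1) (y z : K) :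
    subShift ((1 - q) * (y / q)) (pVal q (y / q) z) = pVal q y z := by
  funext k
  rw [subShift_pVal, ← genFunAt_eq_left hq0 hq]
  simp only [pVal, pPoly, genFunAt, coeff_map]
  split_ifs <;> simp

theorem pVal_swap [CompleteSpace K] {q : K} (hq : ‖q‖ < 1) (y z : K) :
    pVal q y z = pVal q z y := by
  funext k
  rcases lt_or_ge k 0 with hk | hk
  · rw [pVal_neg _ _ _ hk, pVal_neg _ _ _ hk]
  · obtain ⟨n, rfl⟩ := Int.eq_ofNat_of_zero_le hk
    rw [pVal_natCast, pVal_natCast, genFunAt_swap hq]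

theorem subShift_pVal_right [CompleteSpace K] {q : K} (hq0 : q ≠ 0) (hq : ‖q‖ < 1) (y z : K) :
    subShift ((1 - q) * (z / q)) (pVal q y (z / q)) = pVal q y z := by
  rw [pVal_swap hq y, subShift_pVal_left hq0 hq, pVal_swap hq]

theorem subShift_pVal_scale [CompleteSpace K] {q : K} (hq0 : q ≠ 0) (hq : ‖q‖ < 1) (y z : K) :
    subShift (-(1 - q) / q) (pVal q (y / q) (z / q)) = fun k => q⁻¹ ^ k * pVal q y z k := by
  funext k
  rw [subShift_pVal, ← rescale_genFunAt hq0 hq]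
  split_ifs with hk
  · rw [pVal_neg _ _ _ hk, mul_zero]
  · obtain ⟨n, rfl⟩ := Int.eq_ofNat_of_zero_le (not_lt.mp hk)
    rw [Int.toNat_natCast, coeff_rescale, pVal_natCast, zpow_natCast]

theorem eval_phiDet (q y z : K) (n : ℕ) :
    MvPolynomial.eval ![y, z] (phiDet q n) = stairDet (pVal q y z) n n := by
  rw [phiDet, RingHom.map_det]
  rfl

theorem phi_eq_stair (q : K) (N : ℤ) (y z : K) : phi q N y z = stair (pVal q y z) N := by
  unfold phi phiPoly stair
  split_ifs with h
  · rw [eval_phiDet, Int.toNat_of_nonneg h]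
  · rw [map_mul, eval_phiDet, Int.toNat_of_nonneg (show 0 ≤ -N - 1 by omega)]
    simp

end GenFun
end QPThree
end

/-! ### The six equations -/

open QPThree in
theorem proposition3p3 {K : Type*} [NormedField K] [CompleteSpace K]
    (q : K) (hq0 : 0 < ‖q‖) (hq1 : ‖q‖ < 1) (N : ℤ) (y z : K) :
    (y * phi q (N + 1) (y / q) z * phi q N y (z / q)
        - z * phi q (N + 1) y (z / q) * phi q N (y / q) z
      = (y - z) * phi q (N + 1) (y / q) (z / q) * phi q N y z) ∧
    (y * phi q (N + 1) y (z / q) * phi q N (y / q) z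
        - z * phi q (N + 1) (y / q) z * phi q N y (z / q)
      = (y - z) * phi q (N + 1) y z * phi q N (y / q) (z / q)) ∧
    (q ^ (-N - 1) * z * phi q (N + 1) y z * phi q N (y / q) z
        + phi q (N + 1) (y / q) z * phi q N y z
      = (1 + z) * phi q (N + 1) (y / q) (z / q) * phi q N y (q * z)) ∧
    (phi q (N + 1) (y / q) z * phi q (N - 1) y z
        - phi q (N + 1) y z * phi q (N - 1) (y / q) z
      = (1 - q) * (y / q) * phi q N (y / q) z * phi q N y z) ∧
    (phi q (N + 1) y (z / q) * phi q (N - 1) y z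
        - phi q (N + 1) y z * phi q (N - 1) y (z / q)
      = (1 - q) * (z / q) * phi q N y (z / q) * phi q N y z) ∧
    (q ^ (2 * N) * y * phi q N (y / q) z * phi q N y z
        + q ^ N * (1 + z) * phi q N y (q * z) * phi q N (y / q) (z / q)
      = (1 - q ^ (2 * N + 1)) / (1 - q)
          * phi q (N + 1) y z * phi q (N - 1) (y / q) z) := by
  have hq : q ≠ 0 := norm_pos_iff.mp hq0
  have hc : 1 - q ≠ 0 := by
    intro h
    rw [← sub_eq_zero.mp h, norm_one] at hq1
    exact lt_irrefl _ hq1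
  have hy := subShift_pVal_left hq hq1 y z
  have hz := subShift_pVal_right hq hq1 y z
  have hy' := subShift_pVal_left hq hq1 y (z / q)
  have hz' := subShift_pVal_right hq hq1 (y / q) z
  have hx := subShift_pVal_scale hq hq1 y z
  have hx' := subShift_pVal_scale hq hq1 y (q * z)
  rw [mul_div_cancel_left₀ z hq] at hx'
  have hn := isNormalized_pVal hq1 (y / q) (z / q)
  have scale := stair_scale (inv_ne_zero hq)
  have hQ : q ^ N ≠ 0 := zpow_ne_zero _ hq
  set E := q⁻¹ ^ (N * (N + 1) / 2) with hE
  have hE0 : E ≠ 0 := zpow_ne_zero _ (inv_ne_zero hq)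
  -- The scaling factors at N+1 and N-1 are expressed through the factor E at N.
  have d1 : q⁻¹ ^ ((N + 1) * (N + 1 + 1) / 2) = E * (q ^ N * q)⁻¹ := by
    rw [int_triangle_succ, zpow_add₀ (inv_ne_zero hq), inv_zpow q (N + 1), zpow_add_one₀ hq]
  have d0 : q⁻¹ ^ ((N - 1) * (N - 1 + 1) / 2) = E * q ^ N := by
    have h := int_triangle_succ (N - 1)
    rw [sub_add_cancel] at h
    rw [hE, h, sub_add_cancel, zpow_add₀ (inv_ne_zero hq), mul_assoc, inv_zpow q N,
      inv_mul_cancel₀ hQ, mul_one]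
  have eqY : phi q (N + 1) (y / q) z * phi q (N - 1) y z
        - phi q (N + 1) y z * phi q (N - 1) (y / q) z
      = (1 - q) * (y / q) * phi q N (y / q) z * phi q N y z := by
    -- With second parameter 0 only the shift in y remains.
    have h := stair_both (isNormalized_pVal hq1 (y / q) z) ((1 - q) * (y / q)) 0 N
    simp only [subShift_zero, hy, ← phi_eq_stair] at h
    linear_combination h
  refine ⟨?_, ?_, ?_, eqY, ?_, ?_⟩
  · have h := stair_top hn ((1 - q) * (y / q)) ((1 - q) * (z / q)) N
    simp only [hy', hz', hz, ← phi_eq_stair] at h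
    have hcq : (1 - q) / q ≠ 0 := div_ne_zero hc hq
    apply mul_left_cancel₀ hcq
    linear_combination h
  · have h := stair_bottom hn ((1 - q) * (y / q)) ((1 - q) * (z / q)) N
    simp only [hy', hz', hz, ← phi_eq_stair] at h
    have hcq : (1 - q) / q ≠ 0 := div_ne_zero hc hq
    apply mul_left_cancel₀ hcq
    linear_combination h
  -- The pair of factors is now the z-shift and the rescaling; the parameters differ by
  -- (1-q)(1+z)/q.
  · have h := stair_top hn ((1 - q) * (z / q)) (-(1 - q) / q) N
    simp only [hx, hz', hx', scale, d1, ← phi_eq_stair, ← hE] at h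
    have hcE : E * ((1 - q) / q) ≠ 0 := mul_ne_zero hE0 (div_ne_zero hc hq)
    apply mul_left_cancel₀ hcE
    rw [show -N - 1 = -(N + 1) by ring, zpow_neg, zpow_add_one₀ hq]
    linear_combination h
  · have h := stair_both (isNormalized_pVal hq1 y (z / q)) ((1 - q) * (z / q)) 0 N
    simp only [subShift_zero, hz, ← phi_eq_stair] at h
    linear_combination h
  · have h := stair_both hn ((1 - q) * (z / q)) (-(1 - q) / q) N
    simp only [hx, hz', hx', scale, d1, d0, ← phi_eq_stair, ← hE] at h
    -- Dividing by the scaling factor at N+1 leaves q^(2N+1) on the second product; the fourth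
    -- equation then eliminates that product.
    have h' : phi q (N + 1) y z * phi q (N - 1) (y / q) z
        - q ^ N * q ^ N * q * phi q (N + 1) (y / q) z * phi q (N - 1) y z
        = q ^ N * (1 - q) * (1 + z) * phi q N (y / q) (z / q) * phi q N y (q * z) := by
      have hEQ : E * (q ^ N * q)⁻¹ ≠ 0 := mul_ne_zero hE0 (inv_ne_zero (mul_ne_zero hQ hq))
      apply mul_left_cancel₀ hEQ
      field_simp at h ⊢
      linear_combination h
    rw [zpow_add_one₀ hq, two_mul, zpow_add₀ hq, div_mul_eq_mul_div, div_mul_eq_mul_div,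
      eq_div_iff hc]
    have eqY' : q * (phi q (N + 1) (y / q) z * phi q (N - 1) y z
        - phi q (N + 1) y z * phi q (N - 1) (y / q) z)
        = (1 - q) * y * phi q N (y / q) z * phi q N y z := by
      rw [eqY]; field_simp
    linear_combination -h' - q ^ N * q ^ N * eqY'
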